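/- For $n\ge 1$ let $p_n$ denote the $n$-th prime number, so that $p_1=2$, $p_2=3$, and so on. Then \[\lim_{n\to\infty}\frac{\log n}{p_n-p_{n+1}}\left(\frac1{p_{n+1}}\sum_{m=1}^{n}p_m-\frac1{p_n}\sum_{m=1}^{n}p_m\right)=\frac12,\] or, equivalently, \[\lim_{n\to\infty}\frac{\log n}{p_n\,p_{n+1}}\sum_{m=1}^{n}p_m=\frac12.\] -/

import Mathlib

/-- The `n`-th prime number, counted from one: `nthPrime 1 = 2`, `nthPrime 2 = 3`, and so on.
Only the values at `n ≥ 1` are meaningful. -/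
noncomputable def nthPrime (n : ℕ) : ℕ := Nat.nth Nat.Prime (n - 1)

/-- The sum `p_1 + ⋯ + p_n` of the first `n` primes, as a real number. -/
noncomputable def primeSum (n : ℕ) : ℝ := ∑ m ∈ Finset.Icc 1 n, (nthPrime m : ℝ)

/-!
The growth of the primes comes from a Tauberian argument. Since `ζ` has no zeros on `re s = 1`, the
function `-logDeriv ζ s - 1 / (s - 1)` extends continuously to `1 ≤ re s`; hence, for
`g u = ψ (exp u) / exp u`, the Laplace transform of `g - 1` extends continuously to the imaginary
axis. By the Riemann–Lebesgue lemma the averages of `g - 1` against any Fejér kernel tend to `0`.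
As `g u * exp u` is monotone, `g` decreases so slowly that convergence of its averages forces
convergence of `g` itself. So `ψ x ~ x`, the number of primes up to `x` is `~ x / log x`, and
`p_n ~ n log n`. The increments of `n² log n / 2` are also `~ n log n`, so
`p_1 + ⋯ + p_n ~ n² log n / 2`, which gives the second limit. The first sequence agrees with the
second one because `(1 / q - 1 / p) / (p - q) = 1 / (p * q)`.
-/

open Asymptotics Complex Filter FourierTransform MeasureTheory Set Topology

open scoped Real

/-! ### Laplace transforms near the imaginary axis -/

theorem fourierInv_fourier_smul {V E : Type*} [NormedAddCommGroup V] [InnerProductSpace ℝ V]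
    [MeasurableSpace V] [BorelSpace V] [FiniteDimensional ℝ V] [NormedAddCommGroup E]
    [NormedSpace ℂ E] [CompleteSpace E] {f : V → ℂ} {φ : V → E} (hf : Integrable f)
    (hφ : Integrable φ) (v : V) :
    𝓕⁻ (fun t => 𝓕 f t • φ t) v = ∫ u, f u • 𝓕⁻ φ (v - u) := by
  let ψ : V → E := fun t => Real.fourierChar (inner ℝ t v) • φ t
  have hψ : Integrable ψ := by
    simpa [ψ] using (VectorFourier.fourierIntegral_convergent_iff (L := innerₗ V)
      Real.continuous_fourierChar continuous_inner (-v)).2 hφ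
  have hψ_fourier (u : V) : 𝓕 ψ u = 𝓕⁻ φ (v - u) := by
    rw [Real.fourier_eq, Real.fourierInv_eq]
    refine integral_congr_ae (.of_forall fun t => ?_)
    simp only [ψ]
    rw [smul_smul, ← AddChar.map_add_eq_mul, inner_sub_right, neg_add_eq_sub]
  calc 𝓕⁻ (fun t => 𝓕 f t • φ t) v = ∫ t, 𝓕 f t • ψ t := by
        rw [Real.fourierInv_eq]
        exact integral_congr_ae (.of_forall fun t => smul_comm _ _ _)
    _ = ∫ u, f u • 𝓕 ψ u := by
        simpa using! VectorFourier.integral_fourierIntegral_smul_eq_flip (L := innerₗ V)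
          Real.continuous_fourierChar continuous_inner hf hψ
    _ = ∫ u, f u • 𝓕⁻ φ (v - u) := by simp only [hψ_fourier]

/-- The (one-sided) Laplace transform `z ↦ ∫₀^∞ e^{-zu} f(u) du`. -/
noncomputable def laplaceTransform (f : ℝ → ℂ) (z : ℂ) : ℂ :=
  ∫ u in Ioi (0 : ℝ), exp (-z * u) * f u

theorem integrableOn_exp_neg_mul {f : ℝ → ℂ} (hf : MemLp f ⊤ (volume.restrict (Ioi 0)))
    {z : ℂ} (hz : 0 < z.re) : IntegrableOn (fun u : ℝ => exp (-z * u) * f u) (Ioi 0) :=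
  Integrable.mul_of_top_left (integrableOn_exp_mul_complex_Ioi (by simpa using hz) 0) hf

theorem laplaceTransform_add_two_pi_mul_I (f : ℝ → ℂ) (z : ℂ) (t : ℝ) :
    laplaceTransform f (z + 2 * π * t * I) =
      𝓕 ((Ioi 0).indicator fun u : ℝ => exp (-z * u) * f u) t := by
  rw [laplaceTransform, Real.fourier_real_eq_integral_exp_smul,
    ← integral_indicator measurableSet_Ioi]
  refine integral_congr_ae (.of_forall fun u => ?_)
  by_cases hu : u ∈ Ioi (0 : ℝ)
  · simp only [indicator_of_mem hu, smul_eq_mul, ← mul_assoc, ← exp_add]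
    congr 2
    push_cast
    ring
  · simp [hu]

theorem fourierInv_laplaceTransform_mul {f φ : ℝ → ℂ} (hf : MemLp f ⊤ (volume.restrict (Ioi 0)))
    (hφ : Integrable φ) {z : ℂ} (hz : 0 < z.re) (v : ℝ) :
    𝓕⁻ (fun t : ℝ => laplaceTransform f (z + 2 * π * t * I) * φ t) v =
      laplaceTransform (fun u => f u * 𝓕⁻ φ (v - u)) z := by
  have hint := (integrable_indicator_iff measurableSet_Ioi).2 (integrableOn_exp_neg_mul hf hz)
  have hconv := fourierInv_fourier_smul hint hφ v
  simp only [← laplaceTransform_add_two_pi_mul_I, smul_eq_mul] at hconv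
  rw [hconv, laplaceTransform, ← integral_indicator measurableSet_Ioi]
  refine integral_congr_ae (.of_forall fun u => ?_)
  by_cases hu : u ∈ Ioi (0 : ℝ) <;> simp [hu, mul_assoc]

theorem tendsto_laplaceTransform_nhdsGT_zero {f : ℝ → ℂ} (hf : IntegrableOn f (Ioi 0)) :
    Tendsto (fun ε : ℝ => laplaceTransform f ε) (𝓝[>] 0) (𝓝 (∫ u in Ioi (0 : ℝ), f u)) := by
  refine tendsto_integral_filter_of_dominated_convergence (fun u => ‖f u‖)
    (.of_forall fun ε => ?_) ?_ hf.norm (.of_forall fun u => ?_)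
  · have : Continuous fun u : ℝ => exp (-ε * u) := by fun_prop
    exact this.aestronglyMeasurable.mul hf.aestronglyMeasurable
  · filter_upwards [self_mem_nhdsWithin] with ε hε
    filter_upwards [ae_restrict_mem measurableSet_Ioi] with u hu
    rw [norm_mul, norm_exp]
    refine mul_le_of_le_one_left (norm_nonneg _) (Real.exp_le_one_iff.2 ?_)
    simpa using (mul_pos hε hu).le
  · have : Continuous fun ε : ℝ => exp (-ε * u) * f u := by fun_prop
    simpa using (this.tendsto 0).mono_left nhdsWithin_le_nhds

theorem tendsto_fourierInv_comp_mul_nhdsGT_zero {H : ℂ → ℂ} (hH : ContinuousOn H {z | 0 ≤ z.re})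
    {φ : ℝ → ℂ} (hφ : Continuous φ) (hφc : HasCompactSupport φ) (v : ℝ) :
    Tendsto (fun ε : ℝ => 𝓕⁻ (fun t : ℝ => H (ε + 2 * π * t * I) * φ t) v) (𝓝[>] 0)
      (𝓝 (𝓕⁻ (fun t : ℝ => H (2 * π * t * I) * φ t) v)) := by
  simp only [Real.fourierInv_eq']
  have hcont : ContinuousOn (fun ε : ℝ => ∫ t : ℝ, exp (↑(2 * π * inner ℝ t v) * I) •
      (H (ε + 2 * π * t * I) * φ t)) (Ici 0) := by
    refine continuousOn_integral_of_compact_support hφc ?_ fun ε t _ ht => ?_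
    · have hHc : ContinuousOn (fun p : ℝ × ℝ => H (p.1 + 2 * π * p.2 * I)) (Ici 0 ×ˢ univ) :=
        hH.comp (by fun_prop) fun p hp => by simpa using hp.1
      have hexp : Continuous fun p : ℝ × ℝ => exp (↑(2 * π * inner ℝ p.2 v) * I) := by fun_prop
      exact hexp.continuousOn.smul
        (hHc.mul (hφ.comp continuous_snd).continuousOn)
    · simp [image_eq_zero_of_notMem_tsupport ht]
  simpa using (hcont 0 self_mem_Ici).tendsto.mono_left (nhdsWithin_mono 0 Ioi_subset_Ici_self)

theorem tendsto_fourierInv_cocompact {E : Type*} [NormedAddCommGroup E] [NormedSpace ℂ E]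
    (f : ℝ → E) : Tendsto (𝓕⁻ f) (cocompact ℝ) (𝓝 0) := by
  have hneg := (Homeomorph.neg ℝ).isClosedEmbedding.tendsto_cocompact
  exact ((Real.zero_at_infty_fourier f).comp hneg).congr fun v =>
    (Real.fourierInv_eq_fourier_neg f v).symm

theorem tendsto_setIntegral_mul_fourierInv_of_laplaceTransform {f φ : ℝ → ℂ} {H : ℂ → ℂ}
    (hf : MemLp f ⊤ (volume.restrict (Ioi 0))) (hH : ContinuousOn H {z | 0 ≤ z.re})
    (hfH : EqOn (laplaceTransform f) H {z | 0 < z.re})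
    (hφ : Continuous φ) (hφc : HasCompactSupport φ) (hφi : Integrable (𝓕⁻ φ)) :
    Tendsto (fun v : ℝ => ∫ u in Ioi (0 : ℝ), f u * 𝓕⁻ φ (v - u)) atTop (𝓝 0) := by
  have hboundary (v : ℝ) : 𝓕⁻ (fun t : ℝ => H (2 * π * t * I) * φ t) v =
      ∫ u in Ioi (0 : ℝ), f u * 𝓕⁻ φ (v - u) := by
    have hint : IntegrableOn (fun u => f u * 𝓕⁻ φ (v - u)) (Ioi 0) :=
      Integrable.mul_of_top_right (hφi.comp_sub_left v).integrableOn hf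
    refine tendsto_nhds_unique (tendsto_fourierInv_comp_mul_nhdsGT_zero hH hφ hφc v)
      ((tendsto_laplaceTransform_nhdsGT_zero hint).congr' ?_)
    filter_upwards [self_mem_nhdsWithin] with ε hε
    have hε' : 0 < (ε : ℂ).re := hε
    rw [← fourierInv_laplaceTransform_mul hf (hφ.integrable_of_hasCompactSupport hφc) hε']
    congr! 3 with t
    exact hfH (by simpa using hε')
  exact ((tendsto_fourierInv_cocompact fun t : ℝ => H (2 * π * t * I) * φ t).mono_left
    atTop_le_cocompact).congr hboundary

/-! ### The Fejér kernel -/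

/-- The tent function on `[-1, 1]`: a compactly supported multiplier whose inverse Fourier transform
is nonnegative, namely the Fejér kernel. -/
noncomputable def tent (t : ℝ) : ℝ := max 0 (1 - |t|)

theorem continuous_tent : Continuous tent := by unfold tent; fun_prop

theorem tent_neg (t : ℝ) : tent (-t) = tent t := by simp [tent]

theorem tent_of_nonneg_of_le_one {t : ℝ} (h₀ : 0 ≤ t) (h₁ : t ≤ 1) : tent t = 1 - t := by
  simp [tent, abs_of_nonneg h₀, h₁]

theorem support_tent_subset : Function.support tent ⊆ Ioc (-1) 1 := fun t ht => by
  have : |t| < 1 := by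
    by_contra! h
    exact ht (max_eq_left (sub_nonpos.2 h))
  exact ⟨(abs_lt.1 this).1, (abs_lt.1 this).2.le⟩

theorem hasCompactSupport_tent : HasCompactSupport tent :=
  .of_support_subset_isCompact isCompact_Icc (support_tent_subset.trans Ioc_subset_Icc_self)

theorem integral_tent_mul {F : ℝ → ℂ} (hF : Continuous F) :
    ∫ t, tent t * F t = ∫ t in 0..1, (1 - t : ℂ) * (F t + F (-t)) := by
  have htent : Continuous fun t => (tent t : ℂ) := continuous_ofReal.comp continuous_tent
  have hcont : Continuous fun t => tent t * F t := htent.mul hF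
  have hcont_neg : Continuous fun t => tent t * F (-t) := htent.mul (hF.comp continuous_neg)
  have hsupp : (Function.support fun t => tent t * F t) ⊆ Ioc (-1) 1 := fun t ht =>
    support_tent_subset fun h => ht (by simp [h])
  have hneg : ∫ t in -1..0, tent t * F t = ∫ t in 0..1, tent t * F (-t) := by
    simpa [tent_neg] using
      (intervalIntegral.integral_comp_neg (a := 0) (b := 1) fun t => tent t * F t).symm
  rw [← intervalIntegral.integral_eq_integral_of_support_subset hsupp,
    ← intervalIntegral.integral_add_adjacent_intervals (b := 0)
      (hcont.intervalIntegrable _ _) (hcont.intervalIntegrable _ _), hneg,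
    ← intervalIntegral.integral_add (hcont_neg.intervalIntegrable _ _)
      (hcont.intervalIntegrable _ _)]
  refine intervalIntegral.integral_congr fun t ht => ?_
  rw [uIcc_of_le zero_le_one] at ht
  simp only [tent_of_nonneg_of_le_one ht.1 ht.2, ofReal_sub, ofReal_one]
  ring

theorem integral_one_sub_mul_exp {c : ℂ} (hc : c ≠ 0) :
    ∫ t : ℝ in 0..1, (1 - t : ℂ) * exp (c * t) = (exp c - 1 - c) / c ^ 2 := by
  have hderiv (t : ℝ) : HasDerivAt (fun t : ℝ => ((1 - t) / c + 1 / c ^ 2) * exp (c * t))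
      ((1 - t : ℂ) * exp (c * t)) t := by
    have hlin : HasDerivAt (fun z : ℂ => (1 - z) / c + 1 / c ^ 2) (-1 / c) t :=
      (((hasDerivAt_id _).const_sub 1).div_const c).add_const _
    have hexp : HasDerivAt (fun z : ℂ => exp (c * z)) (exp (c * t) * c) t := by
      simpa using ((hasDerivAt_id (t : ℂ)).const_mul c).cexp
    refine (hlin.mul hexp).comp_ofReal.congr_deriv ?_
    field_simp
    ring
  rw [intervalIntegral.integral_eq_sub_of_hasDerivAt (fun t _ => hderiv t)
    (Continuous.intervalIntegrable (by fun_prop) _ _)]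
  simp only [ofReal_one, ofReal_zero, mul_one, mul_zero, exp_zero]
  field_simp
  ring

theorem fourierInv_tent_zero : 𝓕⁻ (fun t => (tent t : ℂ)) 0 = 1 := by
  have hint : ∫ t : ℝ in 0..1, (1 - t : ℂ) = 1 / 2 := by
    have hreal : ∫ t : ℝ in 0..1, 1 - t = 1 / 2 := by
      simp [intervalIntegral.integral_comp_sub_left fun t : ℝ => t]
    rw [← ofReal_one, ← ofReal_ofNat, ← ofReal_div, ← hreal, ← intervalIntegral.integral_ofReal]
    simp only [ofReal_sub]
  have htent := integral_tent_mul (F := 1) continuous_one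
  simp only [Pi.one_apply, mul_one, intervalIntegral.integral_mul_const, hint] at htent
  norm_num [Real.fourierInv_eq', htent]

theorem fourierInv_tent (v : ℝ) :
    𝓕⁻ (fun t => (tent t : ℂ)) v = (Real.sinc (π * v) ^ 2 : ℝ) := by
  rcases eq_or_ne v 0 with rfl | hv
  · simp [fourierInv_tent_zero]
  set c : ℂ := 2 * (π * v : ℝ) * I with hc
  have hv' : (π * v : ℝ) ≠ 0 := mul_ne_zero Real.pi_ne_zero hv
  have hc₀ : c ≠ 0 := by simp [hc, hv, Real.pi_ne_zero]
  have htent : 𝓕⁻ (fun t => (tent t : ℂ)) v =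
      ∫ t : ℝ in 0..1, (1 - t : ℂ) * (exp (c * t) + exp (-c * t)) := by
    have := integral_tent_mul (F := fun t : ℝ => exp (c * t)) (by fun_prop)
    simp only [ofReal_neg, mul_neg, ← neg_mul] at this
    rw [Real.fourierInv_eq', ← this]
    refine integral_congr_ae (.of_forall fun t => ?_)
    simp only [hc, smul_eq_mul, mul_comm (exp _), RCLike.inner_apply, conj_trivial]
    congr 2
    push_cast
    ring
  have hsin : exp c + exp (-c) - 2 = -4 * sin (π * v : ℝ) ^ 2 := by
    rw [hc, ← neg_mul, ← two_cos, cos_two_mul', cos_sq']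
    ring
  simp only [htent, mul_add]
  rw [intervalIntegral.integral_add (Continuous.intervalIntegrable (by fun_prop) _ _)
    (Continuous.intervalIntegrable (by fun_prop) _ _), integral_one_sub_mul_exp hc₀,
    integral_one_sub_mul_exp (neg_ne_zero.2 hc₀), Real.sinc_of_ne_zero hv']
  calc (exp c - 1 - c) / c ^ 2 + (exp (-c) - 1 - -c) / (-c) ^ 2
      = (exp c + exp (-c) - 2) / c ^ 2 := by rw [neg_sq]; ring
    _ = (((Real.sin (π * v) / (π * v)) ^ 2 : ℝ) : ℂ) := by
      rw [hsin, hc, mul_pow, mul_pow, I_sq, ofReal_pow, ofReal_div, ofReal_sin, div_pow]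
      have : ((π * v : ℝ) : ℂ) ≠ 0 := ofReal_ne_zero.2 hv'
      field_simp
      norm_num
      ring

theorem integrable_sinc_pi_mul_sq : Integrable fun x : ℝ => Real.sinc (π * x) ^ 2 := by
  have hcont : Continuous fun x : ℝ => Real.sinc (π * x) ^ 2 :=
    (Real.continuous_sinc.comp (continuous_const_mul π)).pow 2
  refine (integrable_inv_one_add_sq.const_mul 2).mono' hcont.aestronglyMeasurable
    (.of_forall fun x => ?_)
  have hone : Real.sinc (π * x) ^ 2 ≤ 1 := (sq_le_one_iff_abs_le_one _).2 (Real.abs_sinc_le_one _)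
  have hdecay : Real.sinc (π * x) ^ 2 * x ^ 2 ≤ 1 := by
    rcases eq_or_ne x 0 with rfl | hx
    · simp
    rw [Real.sinc_of_ne_zero (mul_ne_zero Real.pi_ne_zero hx), div_pow, mul_pow, mul_comm (π ^ 2),
      ← div_div, div_mul_eq_mul_div, div_mul_cancel₀ _ (pow_ne_zero 2 hx)]
    exact div_le_one_of_le₀ ((Real.sin_sq_le_one _).trans
      (one_le_pow₀ (by linarith [Real.pi_gt_three]))) (sq_nonneg π)
  rw [Real.norm_of_nonneg (sq_nonneg _), ← div_eq_mul_inv, le_div_iff₀ (by positivity)]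
  linarith

theorem integral_sinc_pi_mul_sq : ∫ x : ℝ, Real.sinc (π * x) ^ 2 = 1 := by
  have htent : Continuous fun t => (tent t : ℂ) := continuous_ofReal.comp continuous_tent
  have hinv : 𝓕⁻ (fun t => (tent t : ℂ)) = fun x => ((Real.sinc (π * x) ^ 2 : ℝ) : ℂ) :=
    funext fourierInv_tent
  have hfourier : Integrable (𝓕 fun t => (tent t : ℂ)) := by
    refine (integrable_sinc_pi_mul_sq.ofReal (𝕜 := ℂ)).congr (.of_forall fun x => ?_)
    rw [← neg_neg x, ← Real.fourierInv_eq_fourier_neg, fourierInv_tent, neg_neg, mul_neg,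
      Real.sinc_neg]
    rfl
  have hinversion := htent.fourier_fourierInv_eq
    (htent.integrable_of_hasCompactSupport (hasCompactSupport_tent.comp_left ofReal_zero)) hfourier
  have hzero := congrFun hinversion 0
  rw [hinv, Real.fourier_eq'] at hzero
  have hcomplex : ∫ x : ℝ, ((Real.sinc (π * x) ^ 2 : ℝ) : ℂ) = 1 := by
    simpa [tent, -ofReal_pow] using hzero
  exact_mod_cast (integral_complex_ofReal.symm.trans hcomplex)

/-- The Fejér kernel of scale `R`, normalised to have total mass `1`: the inverse Fourier transform
of `t ↦ tent (t / R)`, written with `sinc` to include the value at `0`. -/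
noncomputable def fejerKernel (R x : ℝ) : ℝ := R * Real.sinc (π * (R * x)) ^ 2

theorem continuous_fejerKernel (R : ℝ) : Continuous (fejerKernel R) :=
  ((Real.continuous_sinc.comp (by fun_prop)).pow 2).const_mul R

theorem integrable_fejerKernel {R : ℝ} (hR : 0 < R) : Integrable (fejerKernel R) :=
  (integrable_sinc_pi_mul_sq.comp_mul_left' hR.ne').const_mul R

theorem fejerKernel_nonneg {R : ℝ} (hR : 0 < R) (x : ℝ) : 0 ≤ fejerKernel R x :=
  mul_nonneg hR.le (sq_nonneg _)

theorem integral_fejerKernel {R : ℝ} (hR : 0 < R) : ∫ x, fejerKernel R x = 1 := by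
  simp only [fejerKernel]
  rw [integral_const_mul, Measure.integral_comp_mul_left fun y => Real.sinc (π * y) ^ 2,
    integral_sinc_pi_mul_sq, abs_of_pos (inv_pos.2 hR), smul_eq_mul, mul_one,
    mul_inv_cancel₀ hR.ne']

theorem tendsto_integral_Icc_fejerKernel {δ : ℝ} (hδ : 0 < δ) :
    Tendsto (fun R => ∫ x in Icc (-δ) δ, fejerKernel R x) atTop (𝓝 1) := by
  have hR : Tendsto (fun R : ℝ => R * δ) atTop atTop := tendsto_id.atTop_mul_const hδ
  rw [← integral_sinc_pi_mul_sq]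
  refine (intervalIntegral_tendsto_integral integrable_sinc_pi_mul_sq
    (tendsto_neg_atTop_atBot.comp hR) hR).congr' ?_
  filter_upwards [eventually_gt_atTop 0] with R hR
  rw [integral_Icc_eq_integral_Ioc, ← intervalIntegral.integral_of_le (by linarith)]
  simp only [fejerKernel]
  rw [intervalIntegral.integral_const_mul,
    intervalIntegral.integral_comp_mul_left (fun y => Real.sinc (π * y) ^ 2) hR.ne',
    smul_eq_mul, mul_inv_cancel_left₀ hR.ne', mul_neg, Function.comp_apply]

theorem fourierInv_comp_div {E : Type*} [NormedAddCommGroup E] [NormedSpace ℂ E] (f : ℝ → E)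
    {R : ℝ} (hR : 0 < R) (v : ℝ) : 𝓕⁻ (fun t => f (t / R)) v = R • 𝓕⁻ f (R * v) := by
  simp only [Real.fourierInv_eq]
  rw [← abs_of_pos hR, ← Measure.integral_comp_div, abs_of_pos hR]
  refine integral_congr_ae (.of_forall fun t => ?_)
  have : inner ℝ (t / R) (R * v) = inner ℝ t v := by
    simp only [RCLike.inner_apply, conj_trivial]
    field_simp
  simp only [this]

theorem fourierInv_tent_comp_div {R : ℝ} (hR : 0 < R) :
    𝓕⁻ (fun t => (tent (t / R) : ℂ)) = fun x => (fejerKernel R x : ℂ) := by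
  ext x
  rw [fourierInv_comp_div (fun t => (tent t : ℂ)) hR, fourierInv_tent, real_smul, fejerKernel,
    ofReal_mul]

/-- The measure with density the Fejér kernel of scale `R`, against which bounded functions are
averaged; a probability measure for `R > 0`. -/
noncomputable def fejerMeasure (R : ℝ) : Measure ℝ :=
  volume.withDensity fun x => ENNReal.ofReal (fejerKernel R x)

theorem isProbabilityMeasure_fejerMeasure {R : ℝ} (hR : 0 < R) :
    IsProbabilityMeasure (fejerMeasure R) where
  measure_univ := by
    rw [fejerMeasure, withDensity_apply _ .univ, setLIntegral_univ,
      ← ofReal_integral_eq_lintegral_ofReal (integrable_fejerKernel hR)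
        (.of_forall (fejerKernel_nonneg hR)), integral_fejerKernel hR, ENNReal.ofReal_one]

theorem integral_fejerMeasure {E : Type*} [NormedAddCommGroup E] [NormedSpace ℝ E] {R : ℝ}
    (hR : 0 < R) (f : ℝ → E) : ∫ x, f x ∂fejerMeasure R = ∫ x, fejerKernel R x • f x := by
  have hmeas : Measurable fun x => ENNReal.ofReal (fejerKernel R x) :=
    (continuous_fejerKernel R).measurable.ennreal_ofReal
  rw [fejerMeasure, integral_withDensity_eq_integral_toReal_smul hmeas (by simp)]
  simp only [ENNReal.toReal_ofReal (fejerKernel_nonneg hR _)]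

theorem tendsto_fejerMeasure_real_Icc {δ : ℝ} (hδ : 0 < δ) :
    Tendsto (fun R => (fejerMeasure R).real (Icc (-δ) δ)) atTop (𝓝 1) := by
  refine (tendsto_integral_Icc_fejerKernel hδ).congr' ?_
  filter_upwards [eventually_gt_atTop 0] with R hR
  rw [← integral_indicator_one measurableSet_Icc, integral_fejerMeasure hR,
    ← integral_indicator measurableSet_Icc]
  refine integral_congr_ae (.of_forall fun x => ?_)
  simp only [← indicator_mul_right, smul_eq_mul, Pi.one_apply, mul_one]

theorem integral_comp_sub_fejerMeasure {R : ℝ} (hR : 0 < R) (f : ℝ → ℂ) (v : ℝ) :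
    ∫ x, f (v - x) ∂fejerMeasure R =
      ∫ u, f u * 𝓕⁻ (fun t => (tent (t / R) : ℂ)) (v - u) := by
  rw [integral_fejerMeasure hR, fourierInv_tent_comp_div hR,
    ← integral_sub_left_eq_self _ volume v]
  simp only [sub_sub_cancel, real_smul, mul_comm]

/-! ### The Wiener–Ikehara theorem -/

section Tauberian

variable {g : ℝ → ℝ} {M A : ℝ}

theorem measurable_of_monotone_mul_exp (hmono : Monotone fun u => g u * Real.exp u) :
    Measurable g := by
  have : g = fun u => g u * Real.exp u * Real.exp (-u) := by
    ext u
    rw [mul_assoc, ← Real.exp_add, add_neg_cancel, Real.exp_zero, mul_one]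
  rw [this]
  exact hmono.measurable.mul (by fun_prop)

theorem le_mul_exp_sub_of_monotone_mul_exp (hmono : Monotone fun u => g u * Real.exp u) {a b : ℝ}
    (hab : a ≤ b) : g a ≤ g b * Real.exp (b - a) := by
  rw [Real.exp_sub, ← mul_div_assoc, le_div_iff₀ (Real.exp_pos a)]
  exact hmono hab

variable (hmono : Monotone fun u => g u * Real.exp u) (h₀ : ∀ u, 0 ≤ g u)

include hmono h₀

theorem le_mul_exp_of_monotone_mul_exp {a b d : ℝ} (hab : a ≤ b) (hd : b - a ≤ d) :
    g a ≤ g b * Real.exp d :=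
  (le_mul_exp_sub_of_monotone_mul_exp hmono hab).trans
    (mul_le_mul_of_nonneg_left (Real.exp_le_exp.2 hd) (h₀ b))

variable (hM : ∀ u, g u ≤ M) (μ : Measure ℝ) [IsProbabilityMeasure μ] (v δ : ℝ)

include hM

theorem integrable_comp_sub_of_monotone_mul_exp : Integrable (fun x => g (v - x)) μ :=
  Integrable.of_bound ((measurable_of_monotone_mul_exp hmono).comp
    (measurable_const_sub v)).aestronglyMeasurable M
    (.of_forall fun _ => by simpa only [Real.norm_of_nonneg (h₀ _)] using hM _)

/- As `g` decays at most like `exp (-u)`, it is at least `g v * exp (-2 * δ)` on `[v, v + 2 * δ]`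
and at most `g v * exp (2 * δ)` on `[v - 2 * δ, v]`. Centring the average at `v + δ`, respectively
`v - δ`, makes the window `[-δ, δ]` sample `g` on these intervals. -/
theorem mul_measureReal_Icc_le_integral :
    g v * μ.real (Icc (-δ) δ) ≤ (∫ x, g (v + δ - x) ∂μ) * Real.exp (2 * δ) := by
  have hint := integrable_comp_sub_of_monotone_mul_exp hmono h₀ hM μ (v + δ)
  calc g v * μ.real (Icc (-δ) δ)
      = ∫ x, (Icc (-δ) δ).indicator (fun _ => g v) x ∂μ := by
        rw [integral_indicator_const _ measurableSet_Icc, smul_eq_mul, mul_comm]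
    _ ≤ ∫ x, g (v + δ - x) * Real.exp (2 * δ) ∂μ := by
        refine integral_mono ((integrable_const _).indicator measurableSet_Icc)
          (hint.mul_const _) (indicator_le' (fun x hx => ?_) fun x _ => ?_)
        · exact le_mul_exp_of_monotone_mul_exp hmono h₀ (by linarith [hx.2]) (by linarith [hx.1])
        · exact mul_nonneg (h₀ _) (Real.exp_pos _).le
    _ = (∫ x, g (v + δ - x) ∂μ) * Real.exp (2 * δ) := integral_mul_const _ _

theorem integral_le_mul_exp_add :
    ∫ x, g (v - δ - x) ∂μ ≤ g v * Real.exp (2 * δ) + M * (1 - μ.real (Icc (-δ) δ)) := by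
  have hint := integrable_comp_sub_of_monotone_mul_exp hmono h₀ hM μ (v - δ)
  have hind : Integrable ((Icc (-δ) δ)ᶜ.indicator fun _ => M) μ :=
    (integrable_const _).indicator measurableSet_Icc.compl
  calc ∫ x, g (v - δ - x) ∂μ
      ≤ ∫ x, g v * Real.exp (2 * δ) + (Icc (-δ) δ)ᶜ.indicator (fun _ => M) x ∂μ := by
        refine integral_mono hint ((integrable_const _).add hind) fun x => ?_
        by_cases hx : x ∈ Icc (-δ) δ
        · have : g (v - δ - x) ≤ g v * Real.exp (2 * δ) :=
            le_mul_exp_of_monotone_mul_exp hmono h₀ (by linarith [hx.1]) (by linarith [hx.2])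
          simpa [hx] using this
        · have : 0 ≤ g v * Real.exp (2 * δ) := mul_nonneg (h₀ v) (Real.exp_pos _).le
          simp only [indicator_of_mem (mem_compl hx)]
          linarith [hM (v - δ - x)]
    _ = g v * Real.exp (2 * δ) + M * (1 - μ.real (Icc (-δ) δ)) := by
        rw [integral_add (integrable_const _) hind, integral_const,
          integral_indicator_const _ measurableSet_Icc.compl, probReal_compl_eq_one_sub
          measurableSet_Icc]
        simp [mul_comm]

theorem tendsto_of_tendsto_integral_of_monotone_mul_exp
    (hμ : ∀ δ > 0, ∃ μ : Measure ℝ, IsProbabilityMeasure μ ∧ 1 - δ ≤ μ.real (Icc (-δ) δ) ∧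
      Tendsto (fun v => ∫ x, g (v - x) ∂μ) atTop (𝓝 A)) :
    Tendsto g atTop (𝓝 A) := by
  let lower : ℝ → ℝ := fun δ => (A - δ - M * δ) / Real.exp (2 * δ)
  let upper : ℝ → ℝ := fun δ => (A + δ) * Real.exp (2 * δ) / (1 - δ)
  have hlower : Tendsto lower (𝓝[>] 0) (𝓝 A) := by
    have : ContinuousAt lower 0 := by fun_prop (disch := positivity)
    simpa [ContinuousAt, lower] using this.tendsto.mono_left nhdsWithin_le_nhds
  have hupper : Tendsto upper (𝓝[>] 0) (𝓝 A) := by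
    have : ContinuousAt upper 0 := by fun_prop (disch := norm_num)
    simpa [ContinuousAt, upper] using this.tendsto.mono_left nhdsWithin_le_nhds
  have hM₀ : 0 ≤ M := (h₀ 0).trans (hM 0)
  have hbounds {δ : ℝ} (hδ : δ ∈ Ioo (0 : ℝ) 1) : ∀ᶠ v in atTop, lower δ ≤ g v ∧ g v ≤ upper δ := by
    obtain ⟨μ, _, hmass, hlim⟩ := hμ δ hδ.1
    have hle := (hlim.comp (tendsto_atTop_add_const_right _ δ tendsto_id)).eventually_lt_const
      (lt_add_of_pos_right A hδ.1)
    have hge := (hlim.comp (tendsto_atTop_add_const_right _ (-δ) tendsto_id)).eventually_const_lt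
      (sub_lt_self A hδ.1)
    filter_upwards [hle, hge] with v hle hge
    simp only [Function.comp_apply, id, ← sub_eq_add_neg] at hle hge
    constructor
    · rw [div_le_iff₀ (Real.exp_pos _)]
      have := integral_le_mul_exp_add hmono h₀ hM μ v δ
      have : M * (1 - μ.real (Icc (-δ) δ)) ≤ M * δ := by gcongr; linarith
      linarith
    · rw [le_div_iff₀ (sub_pos.2 hδ.2)]
      calc g v * (1 - δ) ≤ g v * μ.real (Icc (-δ) δ) := by gcongr; exact h₀ v
        _ ≤ _ := mul_measureReal_Icc_le_integral hmono h₀ hM μ v δ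
        _ ≤ (A + δ) * Real.exp (2 * δ) := by gcongr
  refine tendsto_order.2 ⟨fun a ha => ?_, fun a ha => ?_⟩
  · obtain ⟨δ, hδa, hδ⟩ := ((hlower.eventually_const_lt ha).and (Ioo_mem_nhdsGT one_pos)).exists
    filter_upwards [hbounds hδ] with v hv using hδa.trans_le hv.1
  · obtain ⟨δ, hδa, hδ⟩ := ((hupper.eventually_lt_const ha).and (Ioo_mem_nhdsGT one_pos)).exists
    filter_upwards [hbounds hδ] with v hv using hv.2.trans_lt hδa

end Tauberian

theorem tendsto_integral_comp_sub {E : Type*} [NormedAddCommGroup E] [NormedSpace ℝ E]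
    [CompleteSpace E] (μ : Measure ℝ) [IsProbabilityMeasure μ] {h : ℝ → E} {L : E} {M : ℝ}
    (hmeas : StronglyMeasurable h) (hM : ∀ u, ‖h u‖ ≤ M) (hlim : Tendsto h atTop (𝓝 L)) :
    Tendsto (fun v => ∫ x, h (v - x) ∂μ) atTop (𝓝 L) := by
  have : ∫ _, L ∂μ = L := by simp
  rw [← this]
  refine tendsto_integral_filter_of_dominated_convergence (fun _ => M)
    (.of_forall fun v => (hmeas.comp_measurable (measurable_const_sub v)).aestronglyMeasurable)
    (.of_forall fun v => .of_forall fun x => hM _) (integrable_const _) (.of_forall fun x => ?_)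
  exact hlim.comp (tendsto_atTop_add_const_right _ (-x) tendsto_id)

section

variable {f : ℝ → ℂ} {H : ℂ → ℂ} {M R : ℝ} (hf : Measurable f) (hM : ∀ u, ‖f u‖ ≤ M)
  (hH : ContinuousOn H {z | 0 ≤ z.re}) (hfH : EqOn (laplaceTransform f) H {z | 0 < z.re})
  (hR : 0 < R)

include hf hM hH hfH hR

theorem tendsto_integral_indicator_Ioi_comp_sub_fejerMeasure :
    Tendsto (fun v => ∫ x, (Ioi 0).indicator f (v - x) ∂fejerMeasure R) atTop (𝓝 0) := by
  have htent : Continuous fun t => (tent (t / R) : ℂ) :=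
    continuous_ofReal.comp (continuous_tent.comp (by fun_prop))
  have htent_supp : HasCompactSupport fun t => (tent (t / R) : ℂ) :=
    (hasCompactSupport_tent.comp_homeomorph
      (Homeomorph.mulRight₀ R⁻¹ (inv_ne_zero hR.ne'))).comp_left ofReal_zero
  have htent_int : Integrable (𝓕⁻ fun t => (tent (t / R) : ℂ)) := by
    rw [fourierInv_tent_comp_div hR]
    exact (integrable_fejerKernel hR).ofReal
  refine (tendsto_setIntegral_mul_fourierInv_of_laplaceTransform
    (memLp_top_of_bound hf.aestronglyMeasurable M (.of_forall hM)) hH hfH htent htent_supp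
    htent_int).congr fun v => ?_
  rw [integral_comp_sub_fejerMeasure hR, ← integral_indicator measurableSet_Ioi]
  simp only [indicator_mul_left]

theorem tendsto_integral_comp_sub_fejerMeasure :
    Tendsto (fun v => ∫ x, f (v - x) ∂fejerMeasure R) atTop (𝓝 0) := by
  have := isProbabilityMeasure_fejerMeasure hR
  have hbound (s : Set ℝ) (u : ℝ) : ‖s.indicator f u‖ ≤ M :=
    (norm_indicator_le_norm_self f u).trans (hM u)
  have hint {s : Set ℝ} (hs : MeasurableSet s) (v : ℝ) :
      Integrable (fun x => s.indicator f (v - x)) (fejerMeasure R) :=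
    .of_bound ((hf.indicator hs).comp (measurable_const_sub v)).aestronglyMeasurable M
      (.of_forall fun _ => hbound s _)
  have hsplit (v : ℝ) : ∫ x, f (v - x) ∂fejerMeasure R =
      (∫ x, (Ioi 0).indicator f (v - x) ∂fejerMeasure R) +
        ∫ x, (Ioi 0)ᶜ.indicator f (v - x) ∂fejerMeasure R := by
    rw [← integral_add (hint measurableSet_Ioi v) (hint measurableSet_Ioi.compl v)]
    exact integral_congr_ae (.of_forall fun x =>
      (congrFun (indicator_self_add_compl (Ioi 0) f) (v - x)).symm)
  have hvanish : Tendsto ((Ioi 0)ᶜ.indicator f) atTop (𝓝 0) := by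
    refine tendsto_const_nhds.congr' ?_
    filter_upwards [Ioi_mem_atTop 0] with u hu
    exact (indicator_of_notMem (notMem_compl_iff.2 hu) f).symm
  simpa only [hsplit, add_zero] using
    (tendsto_integral_indicator_Ioi_comp_sub_fejerMeasure hf hM hH hfH hR).add
      (tendsto_integral_comp_sub _ (hf.indicator measurableSet_Ioi.compl).stronglyMeasurable
        (hbound _) hvanish)

end

theorem tendsto_of_eqOn_laplaceTransform_sub {g : ℝ → ℝ} {H : ℂ → ℂ} {M A : ℝ}
    (hmono : Monotone fun u => g u * Real.exp u) (h₀ : ∀ u, 0 ≤ g u) (hM : ∀ u, g u ≤ M)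
    (hH : ContinuousOn H {z | 0 ≤ z.re})
    (hgH : EqOn (laplaceTransform fun u => (g u - A : ℂ)) H {z | 0 < z.re}) :
    Tendsto g atTop (𝓝 A) := by
  refine tendsto_of_tendsto_integral_of_monotone_mul_exp hmono h₀ hM fun δ hδ => ?_
  obtain ⟨R, hRδ, hR⟩ := (((tendsto_fejerMeasure_real_Icc hδ).eventually_const_le
    (sub_lt_self 1 hδ)).and (eventually_gt_atTop 0)).exists
  have hprob := isProbabilityMeasure_fejerMeasure hR
  refine ⟨fejerMeasure R, hprob, hRδ, ?_⟩
  have hmeas : Measurable fun u => (g u - A : ℂ) :=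
    (measurable_of_monotone_mul_exp hmono).complex_ofReal.sub_const _
  have hbound (u : ℝ) : ‖(g u - A : ℂ)‖ ≤ M + |A| := by
    refine (norm_sub_le _ _).trans ?_
    simpa [abs_of_nonneg (h₀ u)] using hM u
  have hlim := tendsto_integral_comp_sub_fejerMeasure hmeas hbound hH hgH hR
  have hint (v : ℝ) : ∫ x, (g (v - x) - A : ℂ) ∂fejerMeasure R =
      ((∫ x, g (v - x) ∂fejerMeasure R) - A : ℝ) := by
    have := integrable_comp_sub_of_monotone_mul_exp hmono h₀ hM (fejerMeasure R) v
    rw [integral_sub this.ofReal (integrable_const _)]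
    simp [integral_complex_ofReal]
  simp only [hint] at hlim
  have hre := (continuous_re.tendsto 0).comp hlim
  simpa [Function.comp_def] using hre.add_const A

section WienerIkehara

variable {f : ℕ → ℝ} {C : ℝ}

theorem LSeries_one_add_eq_mul_laplaceTransform (hf : ∀ n, 0 ≤ f n)
    (hC : ∀ n : ℕ, ∑ k ∈ Finset.Icc 1 n, f k ≤ C * n) {z : ℂ} (hz : 0 < z.re) :
    LSeries (fun n => f n) (1 + z) = (1 + z) *
      laplaceTransform (fun u => ((∑ k ∈ Finset.Icc 1 ⌊Real.exp u⌋₊, f k) / Real.exp u : ℝ)) z := by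
  have hO : (fun n : ℕ => ∑ k ∈ Finset.Icc 1 n, f k) =O[atTop] fun n => (n : ℝ) ^ (1 : ℝ) := by
    refine .of_bound C (.of_forall fun n => ?_)
    rw [Real.rpow_one, Real.norm_of_nonneg (Finset.sum_nonneg fun k _ => hf k),
      Real.norm_of_nonneg n.cast_nonneg]
    exact hC n
  rw [LSeries_eq_mul_integral_of_nonneg f zero_le_one (by simpa using hz) hO hf,
    ← Real.exp_zero, ← integral_comp_exp_Ioi, laplaceTransform]
  congr 1
  refine integral_congr_ae (.of_forall fun u => ?_)
  have hexp : exp u * exp (u * -(1 + z + 1)) = exp (-z * u) / exp u := by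
    rw [← exp_add, ← exp_sub]
    ring_nf
  simp only [real_smul]
  rw [cpow_def_of_ne_zero (by simp), ← ofReal_log (Real.exp_pos u).le, Real.log_exp]
  push_cast
  linear_combination (∑ k ∈ Finset.Icc 1 ⌊Real.exp u⌋₊, (f k : ℂ)) * hexp

theorem sum_Icc_floor_exp_div_exp_nonneg (hf : ∀ n, 0 ≤ f n) (u : ℝ) :
    0 ≤ (∑ k ∈ Finset.Icc 1 ⌊Real.exp u⌋₊, f k) / Real.exp u :=
  div_nonneg (Finset.sum_nonneg fun k _ => hf k) (Real.exp_pos u).le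

theorem sum_Icc_floor_exp_div_exp_le (hf : ∀ n, 0 ≤ f n)
    (hC : ∀ n : ℕ, ∑ k ∈ Finset.Icc 1 n, f k ≤ C * n) (u : ℝ) :
    (∑ k ∈ Finset.Icc 1 ⌊Real.exp u⌋₊, f k) / Real.exp u ≤ C := by
  have hC₀ : 0 ≤ C := by simpa using (hf 1).trans (by simpa using hC 1)
  rw [div_le_iff₀ (Real.exp_pos u)]
  exact (hC _).trans (mul_le_mul_of_nonneg_left (Nat.floor_le (Real.exp_pos u).le) hC₀)

theorem monotone_sum_Icc_floor (hf : ∀ n, 0 ≤ f n) :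
    Monotone fun x : ℝ => ∑ k ∈ Finset.Icc 1 ⌊x⌋₊, f k := fun _ _ hxy =>
  Finset.sum_le_sum_of_subset_of_nonneg (Finset.Icc_subset_Icc_right (Nat.floor_mono hxy))
    fun k _ _ => hf k

theorem memLp_top_sum_Icc_floor_exp_div_exp (hf : ∀ n, 0 ≤ f n)
    (hC : ∀ n : ℕ, ∑ k ∈ Finset.Icc 1 n, f k ≤ C * n) (μ : Measure ℝ) :
    MemLp (fun u => ((∑ k ∈ Finset.Icc 1 ⌊Real.exp u⌋₊, f k) / Real.exp u : ℂ)) ⊤ μ := by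
  have hmeas := ((monotone_sum_Icc_floor hf).measurable.comp Real.measurable_exp).div
    Real.measurable_exp
  refine (MemLp.ofReal (memLp_top_of_bound hmeas.aestronglyMeasurable C
    (.of_forall fun u => ?_))).ae_eq (.of_forall fun u => by simp)
  simp only [Pi.div_apply, Function.comp_apply]
  rw [Real.norm_of_nonneg (sum_Icc_floor_exp_div_exp_nonneg hf u)]
  exact sum_Icc_floor_exp_div_exp_le hf hC u

theorem laplaceTransform_sub_const {g : ℝ → ℂ} (hg : MemLp g ⊤ (volume.restrict (Ioi 0))) (A : ℂ)
    {z : ℂ} (hz : 0 < z.re) :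
    laplaceTransform (fun u => g u - A) z = laplaceTransform g z - A / z := by
  have hz' : (-z).re < 0 := by simpa using hz
  simp only [laplaceTransform, mul_sub]
  rw [integral_sub (integrableOn_exp_neg_mul hg hz)
    ((integrableOn_exp_mul_complex_Ioi hz' 0).mul_const A), integral_mul_const,
    integral_exp_mul_complex_Ioi hz']
  simp [div_eq_mul_inv, mul_comm]

theorem one_add_ne_zero_of_re_nonneg {z : ℂ} (hz : 0 ≤ z.re) : 1 + z ≠ 0 := fun h => by
  have := congrArg re h
  simp only [add_re, one_re, zero_re] at this
  linarith

theorem laplaceTransform_sum_sub_const_eq (hf : ∀ n, 0 ≤ f n)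
    (hC : ∀ n : ℕ, ∑ k ∈ Finset.Icc 1 n, f k ≤ C * n) (A : ℂ) {z : ℂ} (hz : 0 < z.re) :
    laplaceTransform
        (fun u => (∑ k ∈ Finset.Icc 1 ⌊Real.exp u⌋₊, f k : ℝ) / Real.exp u - A) z =
      (LSeries (fun n => f n) (1 + z) - A / z - A) / (1 + z) := by
  have hz₀ : z ≠ 0 := by rintro rfl; simp at hz
  have hz₁ := one_add_ne_zero_of_re_nonneg hz.le
  rw [laplaceTransform_sub_const (memLp_top_sum_Icc_floor_exp_div_exp hf hC _) A hz,
    LSeries_one_add_eq_mul_laplaceTransform hf hC hz]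
  push_cast
  field_simp
  ring

theorem tendsto_sum_Icc_div_of_eqOn_LSeries {F : ℂ → ℂ} {A : ℝ} (hf : ∀ n, 0 ≤ f n)
    (hC : ∀ n : ℕ, ∑ k ∈ Finset.Icc 1 n, f k ≤ C * n) (hF : ContinuousOn F {s | 1 ≤ s.re})
    (hfF : EqOn (fun s => LSeries (fun n => f n) s - A / (s - 1)) F {s | 1 < s.re}) :
    Tendsto (fun x : ℝ => (∑ k ∈ Finset.Icc 1 ⌊x⌋₊, f k) / x) atTop (𝓝 A) := by
  have hH : ContinuousOn (fun z => (F (1 + z) - A) / (1 + z)) {z | 0 ≤ z.re} :=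
    ((hF.comp (by fun_prop) fun z hz => by simpa using hz).sub continuousOn_const).div
      (by fun_prop) fun _ => one_add_ne_zero_of_re_nonneg
  have hlim : Tendsto (fun u => (∑ k ∈ Finset.Icc 1 ⌊Real.exp u⌋₊, f k) / Real.exp u) atTop
      (𝓝 A) := by
    refine tendsto_of_eqOn_laplaceTransform_sub
      (by simpa using! (monotone_sum_Icc_floor hf).comp Real.exp_monotone)
      (sum_Icc_floor_exp_div_exp_nonneg hf) (sum_Icc_floor_exp_div_exp_le hf hC) hH fun z hz => ?_
    have hF_eq := hfF (x := 1 + z) (by simpa using hz)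
    simp only [add_sub_cancel_left] at hF_eq
    simpa only [ofReal_div, ← hF_eq] using laplaceTransform_sum_sub_const_eq hf hC A hz
  refine (hlim.comp Real.tendsto_log_atTop).congr' ?_
  filter_upwards [eventually_gt_atTop 0] with x hx
  simp only [Function.comp_apply, Real.exp_log hx]

end WienerIkehara

/-! ### The prime number theorem -/

theorem riemannZeta₁_ne_zero_of_one_le_re {s : ℂ} (hs : 1 ≤ s.re) : riemannZeta₁ s ≠ 0 := by
  rcases eq_or_ne s 1 with rfl | hs1
  · simp
  · exact right_ne_zero_of_mul
      (riemannZeta_eq_inv_sub_mul hs1 ▸ riemannZeta_ne_zero_of_one_le_re hs)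

theorem LSeries_vonMangoldt_sub_inv {s : ℂ} (hs : 1 < s.re) :
    LSeries (fun n => ArithmeticFunction.vonMangoldt n) s - 1 / (s - 1) =
      -logDeriv riemannZeta₁ s := by
  have hs1 : s - 1 ≠ 0 := sub_ne_zero.2 (by rintro rfl; simp at hs)
  have hζ₁ := riemannZeta₁_ne_zero_of_one_le_re hs.le
  rw [ArithmeticFunction.LSeries_vonMangoldt_eq_deriv_riemannZeta_div hs,
    deriv_riemannZeta_eq_neg_inv_sub_sq_mul_add (sub_ne_zero.1 hs1),
    riemannZeta_eq_inv_sub_mul (sub_ne_zero.1 hs1), logDeriv_apply]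
  field_simp
  ring

theorem tendsto_psi_div_self : Tendsto (fun x => Chebyshev.psi x / x) atTop (𝓝 1) := by
  have hcont : ContinuousOn (fun s => -logDeriv riemannZeta₁ s) {s | 1 ≤ s.re} :=
    (differentiable_riemannZeta₁.deriv.continuous.continuousOn.div
      differentiable_riemannZeta₁.continuous.continuousOn
      fun _ => riemannZeta₁_ne_zero_of_one_le_re).neg
  have hpsi (x : ℝ) : Chebyshev.psi x =
      ∑ k ∈ Finset.Icc 1 ⌊x⌋₊, ArithmeticFunction.vonMangoldt k := rfl
  simp only [hpsi]
  refine tendsto_sum_Icc_div_of_eqOn_LSeries (C := Real.log 4 + 4)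
    (fun _ => ArithmeticFunction.vonMangoldt_nonneg) (fun n => ?_) hcont fun s hs => ?_
  · simpa [hpsi] using Chebyshev.psi_le_const_mul_self n.cast_nonneg
  · simpa using LSeries_vonMangoldt_sub_inv hs

theorem tendsto_theta_div_self : Tendsto (fun x => Chebyshev.theta x / x) atTop (𝓝 1) := by
  have hsqrt : (fun x : ℝ => √x) =o[atTop] fun x : ℝ => x := by
    refine isLittleO_of_tendsto (fun x hx => by simp [hx]) ?_
    simpa only [Real.sqrt_div_self', one_div] using! Real.tendsto_sqrt_atTop.inv_tendsto_atTop
  have hdiff := (Chebyshev.isBigO_psi_sub_theta_sqrt.trans_isLittleO hsqrt).tendsto_div_nhds_zero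
  simpa [sub_div] using tendsto_psi_div_self.sub hdiff

theorem primeCounting_isEquivalent :
    (fun x : ℝ => (Nat.primeCounting ⌊x⌋₊ : ℝ)) ~[atTop] fun x => x / Real.log x := by
  have hθ : (fun x => Chebyshev.theta x / Real.log x) ~[atTop] fun x => x / Real.log x := by
    refine .div (isEquivalent_of_tendsto_one tendsto_theta_div_self) .refl
  have hsq : (fun x : ℝ => x / Real.log x ^ 2) =o[atTop] fun x => x / Real.log x := by
    refine isLittleO_of_tendsto' ?_ (Real.tendsto_log_atTop.inv_tendsto_atTop.congr' ?_) <;>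
      filter_upwards [eventually_gt_atTop 1] with x hx
    · simp [(Real.log_pos hx).ne', (zero_lt_one.trans hx).ne']
    · have := Real.log_pos hx
      simp only [Pi.inv_apply]
      field_simp
  have hθ' := hθ.add_isLittleO
    (Chebyshev.primeCounting_sub_theta_div_log_isBigO.trans_isLittleO hsq)
  exact hθ'.congr_left (.of_forall fun x => by simp)

/-! ### The sum of the first primes -/

theorem isEquivalent_mul_log_of_isEquivalent_div_log {α : Type*} {l : Filter α} {u v : α → ℝ}
    (hv : Tendsto v l atTop) (h : u ~[l] fun x => v x / Real.log (v x)) :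
    v ~[l] fun x => u x * Real.log (u x) := by
  have hlogv : Tendsto (fun x => Real.log (v x)) l atTop := Real.tendsto_log_atTop.comp hv
  have hv₁ : ∀ᶠ x in l, 1 < v x := hv.eventually_gt_atTop 1
  have hquot : Tendsto (fun x => v x / Real.log (v x)) l atTop := by
    have h := Real.isLittleO_log_id_atTop.tendsto_div_nhds_zero.comp hv
    refine ((tendsto_nhdsWithin_iff.2 ⟨h, ?_⟩).inv_tendsto_nhdsGT_zero).congr fun x => by simp
    filter_upwards [hv₁] with x hx using div_pos (Real.log_pos hx) (zero_lt_one.trans hx)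
  have hloglog : (fun x => Real.log (Real.log (v x))) =o[l] fun x => Real.log (v x) :=
    Real.isLittleO_log_id_atTop.comp_tendsto hlogv
  have hlogu : (fun x => Real.log (u x)) ~[l] fun x => Real.log (v x) := by
    refine (h.log hquot).trans ((IsEquivalent.refl.sub_isLittleO hloglog).congr_left ?_)
    filter_upwards [hv₁] with x hx
    exact (Real.log_div (zero_lt_one.trans hx).ne' (Real.log_pos hx).ne').symm
  refine (h.mul hlogu).symm.congr_left ?_
  filter_upwards [hv₁] with x hx
  exact div_mul_cancel₀ _ (Real.log_pos hx).ne'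

theorem primeCounting_nthPrime {n : ℕ} (hn : 1 ≤ n) : Nat.primeCounting (nthPrime n) = n := by
  rw [nthPrime, Nat.primeCounting, Nat.primeCounting',
    Nat.count_nth_succ_of_infinite Nat.infinite_setOfPred_prime, Nat.sub_add_cancel hn]

theorem le_nthPrime (n : ℕ) : n ≤ nthPrime n := by
  have := Nat.add_two_le_nth_prime (n - 1)
  rw [nthPrime]
  omega

theorem nthPrime_pos (n : ℕ) : 0 < nthPrime n := (Nat.prime_nth_prime _).pos

theorem nthPrime_lt_nthPrime_succ {n : ℕ} (hn : 1 ≤ n) : nthPrime n < nthPrime (n + 1) :=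
  Nat.nth_strictMono Nat.infinite_setOfPred_prime (by omega)

theorem nthPrime_isEquivalent :
    (fun n => (nthPrime n : ℝ)) ~[atTop] fun n => (n : ℝ) * Real.log n := by
  have hp : Tendsto (fun n => (nthPrime n : ℝ)) atTop atTop :=
    tendsto_atTop_mono (fun n => Nat.cast_le.2 (le_nthPrime n)) tendsto_natCast_atTop_atTop
  refine isEquivalent_mul_log_of_isEquivalent_div_log hp
    ((primeCounting_isEquivalent.comp_tendsto hp).congr_left ?_)
  filter_upwards [eventually_ge_atTop 1] with n hn
  simp only [Function.comp_apply, Nat.floor_natCast, primeCounting_nthPrime hn]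

theorem nthPrime_succ_isEquivalent :
    (fun n => (nthPrime (n + 1) : ℝ)) ~[atTop] fun n => (n : ℝ) * Real.log n := by
  have hsucc : (fun n : ℕ => ((n + 1 : ℕ) : ℝ)) ~[atTop] fun n => (n : ℝ) := by
    simpa using! IsEquivalent.refl.add_isLittleO
      ((isLittleO_const_id_atTop (1 : ℝ)).comp_tendsto tendsto_natCast_atTop_atTop)
  exact (nthPrime_isEquivalent.comp_tendsto (tendsto_add_atTop_nat 1)).trans
    (hsucc.mul (hsucc.log tendsto_natCast_atTop_atTop))

theorem isEquivalent_sum_range {u v : ℕ → ℝ} (h : u ~[atTop] v) (hv : ∀ n, 0 ≤ v n)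
    (hsum : Tendsto (fun n => ∑ i ∈ Finset.range n, v i) atTop atTop) :
    (fun n => ∑ i ∈ Finset.range n, u i) ~[atTop] fun n => ∑ i ∈ Finset.range n, v i :=
  (h.isLittleO.sum_range hv hsum).congr_left fun n => by simp

theorem sq_mul_log_add_one_sub_log_mem_Icc {x : ℝ} (hx : 0 ≤ x) :
    x ^ 2 * (Real.log (x + 1) - Real.log x) ∈ Icc 0 x := by
  rcases hx.eq_or_lt with rfl | hx
  · simp
  have hlog : Real.log (x + 1) - Real.log x ≤ 1 / x := by
    rw [← Real.log_div (by positivity) hx.ne']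
    refine (Real.log_le_sub_one_of_pos (by positivity)).trans_eq ?_
    field_simp
    ring
  refine ⟨mul_nonneg (sq_nonneg x) (sub_nonneg.2 (Real.log_le_log hx (by linarith))), ?_⟩
  calc x ^ 2 * (Real.log (x + 1) - Real.log x) ≤ x ^ 2 * (1 / x) := by gcongr
    _ = x := by field_simp

theorem abs_sq_mul_log_increment_sub_le {x : ℝ} (hx : 0 ≤ x) :
    |((x + 1) ^ 2 * Real.log (x + 1) / 2 - x ^ 2 * Real.log x / 2) -
      (x + 1) * Real.log (x + 1)| ≤ x + 1 := by
  obtain ⟨hlower, hupper⟩ := sq_mul_log_add_one_sub_log_mem_Icc hx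
  have hlog_nonneg : 0 ≤ Real.log (x + 1) := Real.log_nonneg (by linarith)
  have hlog_le : Real.log (x + 1) ≤ x + 1 := Real.log_le_self (by positivity)
  rw [show (x + 1) ^ 2 * Real.log (x + 1) / 2 - x ^ 2 * Real.log x / 2 -
    (x + 1) * Real.log (x + 1) =
      (x ^ 2 * (Real.log (x + 1) - Real.log x) - Real.log (x + 1)) / 2 by ring, abs_le]
  constructor <;> linarith

theorem sq_mul_log_increment_isEquivalent :
    (fun n : ℕ => ((n + 1 : ℕ) : ℝ) ^ 2 * Real.log (n + 1 : ℕ) / 2 - (n : ℝ) ^ 2 * Real.log n / 2)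
      ~[atTop] fun n => ((n + 1 : ℕ) : ℝ) * Real.log (n + 1 : ℕ) := by
  have hlittle : (fun x : ℝ => x) =o[atTop] fun x => x * Real.log x := by
    simpa using (isBigO_refl (fun x : ℝ => x) atTop).mul_isLittleO
      (Real.isLittleO_const_log_atTop (c := 1))
  have hsucc : Tendsto (fun n : ℕ => ((n + 1 : ℕ) : ℝ)) atTop atTop :=
    tendsto_natCast_atTop_atTop.comp (tendsto_add_atTop_nat 1)
  refine IsBigO.trans_isLittleO (.of_norm_le fun n => ?_) (hlittle.comp_tendsto hsucc)
  simpa using! abs_sq_mul_log_increment_sub_le n.cast_nonneg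

theorem primeSum_eq_sum_range (n : ℕ) :
    primeSum n = ∑ i ∈ Finset.range n, (nthPrime (i + 1) : ℝ) := by
  rw [primeSum, Finset.range_eq_Ico, Finset.sum_Ico_add' (fun m => (nthPrime m : ℝ)) 0 n 1]
  rfl

theorem primeSum_isEquivalent :
    primeSum ~[atTop] fun n => (n : ℝ) ^ 2 * Real.log n / 2 := by
  let a : ℕ → ℝ := fun n => (n : ℝ) ^ 2 * Real.log n / 2
  have ha_succ (n : ℕ) : a n ≤ a (n + 1) := by
    rcases n.eq_zero_or_pos with rfl | hn
    · simp [a]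
    · simp only [a]
      gcongr <;> simp
  have ha_sum (n : ℕ) : ∑ i ∈ Finset.range n, (a (i + 1) - a i) = a n := by
    rw [Finset.sum_range_sub]
    simp [a]
  have ha_atTop : Tendsto a atTop atTop :=
    (((tendsto_pow_atTop two_ne_zero).atTop_mul_atTop₀ Real.tendsto_log_atTop).comp
      tendsto_natCast_atTop_atTop).atTop_div_const two_pos
  have hinc : (fun i => (nthPrime (i + 1) : ℝ)) ~[atTop] fun i => a (i + 1) - a i :=
    (nthPrime_isEquivalent.comp_tendsto (tendsto_add_atTop_nat 1)).trans
      sq_mul_log_increment_isEquivalent.symm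
  simpa only [ha_sum, ← primeSum_eq_sum_range] using isEquivalent_sum_range hinc
    (fun i => sub_nonneg.2 (ha_succ i)) (by simpa only [ha_sum] using ha_atTop)

theorem tendsto_log_div_nthPrime_mul_primeSum :
    Tendsto (fun n : ℕ => Real.log n / ((nthPrime n : ℝ) * nthPrime (n + 1)) * primeSum n)
      atTop (𝓝 (1 / 2)) := by
  have h := (IsEquivalent.refl (u := fun n : ℕ => Real.log n)).div
    (nthPrime_isEquivalent.mul nthPrime_succ_isEquivalent) |>.mul primeSum_isEquivalent
  refine h.symm.tendsto_nhds (tendsto_const_nhds.congr' ?_)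
  filter_upwards [eventually_gt_atTop 1] with n hn
  have hlog : 0 < Real.log n := Real.log_pos (Nat.one_lt_cast.2 hn)
  simp only [Pi.mul_apply, Pi.div_apply]
  field_simp

theorem div_sub_mul_one_div_sub_one_div {K : Type*} [Field K] {p q : K} (hp : p ≠ 0) (hq : q ≠ 0)
    (hpq : p ≠ q) (L S : K) :
    L / (p - q) * (1 / q * S - 1 / p * S) = L / (p * q) * S := by
  have := sub_ne_zero.2 hpq
  field_simp

theorem proposition1p1 :
    Filter.Tendsto
      (fun n : ℕ =>
        Real.log (n : ℝ) / ((nthPrime n : ℝ) - (nthPrime (n + 1) : ℝ)) *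
          (1 / (nthPrime (n + 1) : ℝ) * primeSum n - 1 / (nthPrime n : ℝ) * primeSum n))
      Filter.atTop (nhds (1 / 2 : ℝ)) ∧
    Filter.Tendsto
      (fun n : ℕ =>
        Real.log (n : ℝ) / ((nthPrime n : ℝ) * (nthPrime (n + 1) : ℝ)) * primeSum n)
      Filter.atTop (nhds (1 / 2 : ℝ)) := by
  refine ⟨tendsto_log_div_nthPrime_mul_primeSum.congr' ?_, tendsto_log_div_nthPrime_mul_primeSum⟩
  filter_upwards [eventually_ge_atTop 1] with n hn
  exact (div_sub_mul_one_div_sub_one_div (Nat.cast_ne_zero.2 (nthPrime_pos n).ne')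
    (Nat.cast_ne_zero.2 (nthPrime_pos (n + 1)).ne')
    (Nat.cast_injective.ne (nthPrime_lt_nthPrime_succ hn).ne) _ _).symm
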